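/- There is an absolute constant $c > 0$ such that for every finite set $A \subset \mathbb{C}$ with $|A| \ge 2$, $$|A + A\cdot A| = |\{x + yw : x, y, w \in A\}| \ \ge\ c\,\frac{|A|^{3/2}}{\sqrt{\log |A|}},$$ where $\log$ is the natural logarithm, $A\cdot A = \{xy : x, y \in A\}$ and $X + Y = \{x + y : x\in X,\ y \in Y\}$. -/

import Mathlib

open scoped Pointwise

/-! Let `B` contain all `a + b * x`, and let `p x` be a nearest neighbour of `x` in `A`. For `b ≠
0`, the disc about `a + b * x` through `a + b * p x` holds O(#B / #A) points of `B` for at least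
half of the `x`, as such discs overlap boundedly. So `(x, a + b * x, a + b * p x)` takes at most #A
· #B · O(#B / #A) values over these triples; it determines `(a, b, x)`, so #A ^ 3 ≪ #B ^ 2. No
logarithm is lost. -/

open Finset in
/-- A point lies in boundedly many of the closed discs `closedBall s (r s)`, `s ∈ T`, when
distinct centres are at distance at least the radius of either disc. -/
theorem card_le_of_separated_discs (T : Finset ℂ) (z : ℂ)
    (h : ∀ s ∈ T, ∀ t ∈ T, s ≠ t → ‖s - z‖ ≤ ‖s - t‖) : T.card ≤ 25 := by
  set u : ℂ → ℂ := fun s => (s - z) / (‖s - z‖ : ℂ) with hu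
  have hu1 : ∀ s, ‖u s‖ ≤ 1 := by
    intro s
    simp only [hu, norm_div, Complex.norm_real, norm_norm]
    exact div_self_le_one _
  have hus : ∀ s, s - z = (‖s - z‖ : ℂ) * u s := by
    intro s
    by_cases hs : s - z = 0
    · simp [hs]
    · have : (‖s - z‖ : ℂ) ≠ 0 := by simpa using hs
      simp only [hu]
      field_simp
  have key : ∀ s ∈ T, ∀ t ∈ T, s ≠ t → ‖s - z‖ ≤ ‖t - z‖ → 1 ≤ ‖u s - u t‖ := by
    intro s hs t ht hst hle
    by_contra! hlt
    have h2 := h t ht s hs hst.symm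
    rcases (norm_nonneg (s - z)).eq_or_lt with h0 | h0
    -- Here `s = z`, and `u s = 0` by the convention for division by zero.
    · have hs0 : u s = 0 := by simp [hu, ← h0]
      have ht0 : t - z ≠ 0 := by
        intro h1
        apply hst
        rw [h1, norm_zero] at hle
        have := norm_le_zero_iff.1 hle
        rw [sub_eq_zero] at this h1
        rw [this, h1]
      rw [hs0, zero_sub, norm_neg] at hlt
      have : ‖u t‖ = 1 := by
        simp only [hu, norm_div, Complex.norm_real, norm_norm]
        exact div_self (norm_ne_zero_iff.2 ht0)
      linarith
    · have e : t - s = (‖s - z‖ : ℂ) * (u t - u s) + ((‖t - z‖ - ‖s - z‖ : ℝ) : ℂ) * u t := by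
        push_cast
        linear_combination hus t - hus s
      have h3 : ‖t - s‖ ≤ ‖s - z‖ * ‖u t - u s‖ + (‖t - z‖ - ‖s - z‖) * ‖u t‖ := by
        conv_lhs => rw [e]
        refine (norm_add_le _ _).trans ?_
        rw [norm_mul, norm_mul, Complex.norm_real, Complex.norm_real, norm_norm,
          Real.norm_of_nonneg (sub_nonneg.2 hle)]
      rw [norm_sub_rev (u s)] at hlt
      have h4 := mul_lt_mul_of_pos_left hlt h0
      have h5 := mul_le_mul_of_nonneg_left (hu1 t) (sub_nonneg.2 hle)
      linarith
  have key' : ∀ s ∈ T, ∀ t ∈ T, s ≠ t → 1 ≤ ‖u s - u t‖ := by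
    intro s hs t ht hst
    rcases le_total ‖s - z‖ ‖t - z‖ with hle | hle
    · exact key s hs t ht hst hle
    · rw [norm_sub_rev]
      exact key t ht s hs hst.symm hle
  -- Pigeonhole on a 5 × 5 grid of cells of side 1/2, whose diameter is less than 1.
  have hfl : ∀ x : ℝ, |x| ≤ 1 → ⌊2 * x⌋ ∈ Icc (-2 : ℤ) 2 := by
    intro x hx
    obtain ⟨h1, h2⟩ := abs_le.1 hx
    rw [mem_Icc]
    refine ⟨Int.le_floor.2 (by push_cast; linarith), ?_⟩
    rw [← Int.lt_add_one_iff, Int.floor_lt]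
    push_cast
    linarith
  have hfd : ∀ x y : ℝ, ⌊2 * x⌋ = ⌊2 * y⌋ → (x - y) ^ 2 ≤ 1 / 4 := by
    intro x y hxy
    have h1 := Int.abs_sub_lt_one_of_floor_eq_floor hxy
    rw [abs_lt] at h1
    nlinarith
  have hc : (Icc (-2 : ℤ) 2 ×ˢ Icc (-2 : ℤ) 2).card = 25 := by decide
  rw [← hc]
  refine card_le_card_of_injOn (fun s => (⌊2 * (u s).re⌋, ⌊2 * (u s).im⌋)) ?_ ?_
  · intro s _
    exact mem_product.2 ⟨hfl _ ((Complex.abs_re_le_norm _).trans (hu1 s)),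
      hfl _ ((Complex.abs_im_le_norm _).trans (hu1 s))⟩
  · intro s hs t ht hst
    by_contra hne
    have h1 := key' s hs t ht hne
    obtain ⟨hr, hi⟩ := Prod.mk.inj hst
    have h2 := hfd _ _ hr
    have h3 := hfd _ _ hi
    have h4 : ‖u s - u t‖ ^ 2 = ((u s).re - (u t).re) ^ 2 + ((u s).im - (u t).im) ^ 2 := by
      rw [Complex.sq_norm, Complex.normSq_apply, Complex.sub_re, Complex.sub_im]
      ring
    nlinarith

open Finset in
/-- At most `k / n` points `y'` of `B` have at most `k / n` points of `B` no farther from `y`. -/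
theorem card_near_le (B : Finset ℂ) (y : ℂ) (n k : ℕ) :
    n * (B.filter fun y' => n * (B.filter fun w => ‖w - y‖ ≤ ‖y' - y‖).card ≤ k).card ≤ k := by
  set F := B.filter fun y' => n * (B.filter fun w => ‖w - y‖ ≤ ‖y' - y‖).card ≤ k with hF
  rcases F.eq_empty_or_nonempty with h | h
  · simp [h]
  · obtain ⟨y', hy', hmax⟩ := F.exists_max_image (fun w => ‖w - y‖) h
    refine le_trans (Nat.mul_le_mul_left n (card_le_card ?_)) (mem_filter.1 hy').2
    intro w hw
    exact mem_filter.2 ⟨(mem_filter.1 hw).1, hmax w hw⟩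

open Finset in
/-- If an injective affine map `x ↦ a + b * x` sends `A` into `B`, then for at least half of the
points of `A` the disc around the image reaching to the image of the nearest neighbour contains
at most `50 * #B / #A` points of `B`. -/
theorem half_card_le_good (A B : Finset ℂ) (p : ℂ → ℂ)
    (hp : ∀ x ∈ A, ∀ t ∈ A, t ≠ x → ‖p x - x‖ ≤ ‖t - x‖) (a b : ℂ) (hb : b ≠ 0) :
    A.card ≤ 2 * (A.filter fun x => A.card * (B.filter fun w =>
      ‖w - (a + b * x)‖ ≤ ‖(a + b * p x) - (a + b * x)‖).card ≤ 50 * B.card).card := by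
  set k : ℂ → ℕ := fun x => (B.filter fun w =>
      ‖w - (a + b * x)‖ ≤ ‖(a + b * p x) - (a + b * x)‖).card with hk
  have hsum : ∑ x ∈ A, k x ≤ 25 * B.card := by
    have h1 : ∑ x ∈ A, k x = ∑ w ∈ B, (A.filter fun x =>
        ‖w - (a + b * x)‖ ≤ ‖(a + b * p x) - (a + b * x)‖).card :=
      sum_card_bipartiteAbove_eq_sum_card_bipartiteBelow _
    rw [h1, mul_comm, ← smul_eq_mul]
    refine sum_le_card_nsmul _ _ _ fun w _ => ?_
    refine card_le_of_separated_discs _ ((w - a) / b) ?_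
    intro s hs t ht hst
    obtain ⟨hsA, hs⟩ := mem_filter.1 hs
    obtain ⟨htA, -⟩ := mem_filter.1 ht
    have h2 := hp s hsA t htA hst.symm
    have e1 : w - (a + b * s) = -(b * (s - (w - a) / b)) := by field_simp; ring
    have e2 : (a + b * p s) - (a + b * s) = b * (p s - s) := by ring
    rw [e1, e2, norm_neg, norm_mul, norm_mul] at hs
    rw [norm_sub_rev s t]
    exact (le_of_mul_le_mul_left hs (norm_pos_iff.2 hb)).trans h2
  have hsplit := card_filter_add_card_filter_not (s := A) (fun x => A.card * k x ≤ 50 * B.card)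
  set G := A.filter fun x => A.card * k x ≤ 50 * B.card
  set H := A.filter fun x => ¬ A.card * k x ≤ 50 * B.card with hH
  -- Markov's inequality: the threshold is twice the bound on the average.
  have h3 : H.card * (50 * B.card + 1) ≤ A.card * (25 * B.card) := by
    calc H.card * (50 * B.card + 1) ≤ ∑ x ∈ H, A.card * k x := by
          rw [← smul_eq_mul]
          exact card_nsmul_le_sum _ _ _ fun x hx => not_le.1 (mem_filter.1 hx).2
      _ ≤ ∑ x ∈ A, A.card * k x := sum_le_sum_of_subset (filter_subset _ _)
      _ = A.card * ∑ x ∈ A, k x := (mul_sum _ _ _).symm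
      _ ≤ _ := Nat.mul_le_mul_left _ hsum
  by_contra! hlt
  nlinarith

open Finset in
/-- A set containing the images of `A` under all the affine maps `x ↦ a + b * x`, `a, b ∈ A`,
has at least `(#A ^ 3 / 200) ^ (1 / 2)` elements. -/
theorem card_pow_three_le (A B : Finset ℂ) (hA : 2 ≤ A.card)
    (hB : ∀ a ∈ A, ∀ b ∈ A, ∀ x ∈ A, a + b * x ∈ B) : A.card ^ 3 ≤ 200 * B.card ^ 2 := by
  have hnear : ∀ x ∈ A, ∃ q ∈ A, q ≠ x ∧ ∀ t ∈ A, t ≠ x → ‖q - x‖ ≤ ‖t - x‖ := by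
    intro x hx
    have : (A.erase x).Nonempty := by
      rw [← card_pos, card_erase_of_mem hx]; omega
    obtain ⟨q, hq, hmin⟩ := (A.erase x).exists_min_image (fun t => ‖t - x‖) this
    exact ⟨q, mem_of_mem_erase hq, ne_of_mem_erase hq,
      fun t ht htx => hmin t (mem_erase.2 ⟨htx, ht⟩)⟩
  choose! p hpA hpne hp using hnear
  set near : ℂ → Finset ℂ := fun y => B.filter fun y' =>
    A.card * (B.filter fun w => ‖w - y‖ ≤ ‖y' - y‖).card ≤ 50 * B.card with hnr
  set T : Finset (Σ _ : ℂ × ℂ, ℂ) := (A ×ˢ B).sigma fun q => near q.2 with hT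
  set good : ℂ × ℂ → Finset ℂ := fun l => A.filter fun x => A.card * (B.filter fun w =>
      ‖w - (l.1 + l.2 * x)‖ ≤ ‖(l.1 + l.2 * p x) - (l.1 + l.2 * x)‖).card ≤ 50 * B.card with hgd
  -- Dropping `b = 0` keeps the maps injective.
  set L : Finset (Σ _ : ℂ × ℂ, ℂ) := (A ×ˢ A.erase 0).sigma good with hL
  have hTcard : T.card ≤ 50 * B.card ^ 2 := by
    have h1 : A.card * T.card ≤ A.card * (50 * B.card ^ 2) := by
      rw [hT, card_sigma, mul_sum]
      refine (sum_le_card_nsmul _ _ (50 * B.card) fun q _ => card_near_le B q.2 _ _).trans ?_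
      rw [card_product, smul_eq_mul]
      apply le_of_eq
      ring
    exact Nat.le_of_mul_le_mul_left h1 (by omega)
  have hLT : L.card ≤ T.card := by
    refine card_le_card_of_injOn (fun l => ⟨(l.2, l.1.1 + l.1.2 * l.2), l.1.1 + l.1.2 * p l.2⟩)
      ?_ ?_
    · rintro ⟨⟨a, b⟩, x⟩ hl
      simp only [hL, hgd, coe_sigma, Set.mem_sigma_iff, mem_coe, mem_product, mem_erase,
        mem_filter] at hl
      obtain ⟨⟨ha, -, hb⟩, hx, hg⟩ := hl
      simp only [hT, hnr, coe_sigma, Set.mem_sigma_iff, mem_coe, mem_product, mem_filter]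
      exact ⟨⟨hx, hB a ha b hb x hx⟩, hB a ha b hb _ (hpA x hx), hg⟩
    · rintro ⟨⟨a, b⟩, x⟩ hl ⟨⟨a', b'⟩, x'⟩ - h
      simp only [hL, hgd, coe_sigma, Set.mem_sigma_iff, mem_coe, mem_filter] at hl
      have hx := hl.2.1
      simp only [Sigma.mk.injEq, Prod.mk.injEq, heq_eq_eq] at h
      obtain ⟨⟨rfl, h1⟩, h2⟩ := h
      -- Values at two distinct points determine an affine map.
      have h3 : (b - b') * (p x - x) = 0 := by linear_combination h2 - h1
      have h4 : b = b' :=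
        sub_eq_zero.1 ((mul_eq_zero.1 h3).resolve_right (sub_ne_zero.2 (hpne x hx)))
      subst h4
      have h5 : a = a' := add_right_cancel h1
      rw [h5]
  have hLcard : A.card * (A.card - 1) * A.card ≤ 2 * L.card := by
    rw [hL, card_sigma, mul_sum]
    calc A.card * (A.card - 1) * A.card ≤ (A ×ˢ A.erase 0).card * A.card := by
          rw [card_product]
          exact Nat.mul_le_mul_right _ (Nat.mul_le_mul_left _ pred_card_le_card_erase)
      _ ≤ _ := by
          rw [← smul_eq_mul]
          refine card_nsmul_le_sum _ _ _ fun l hl => ?_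
          exact half_card_le_good A B p hp l.1 l.2 (mem_erase.1 (mem_product.1 hl).2).1
  obtain ⟨m, hm⟩ : ∃ m, A.card = m + 2 := ⟨A.card - 2, by omega⟩
  rw [hm] at hLcard ⊢
  have h6 : m + 2 - 1 = m + 1 := by omega
  rw [h6] at hLcard
  nlinarith [Nat.zero_le (m ^ 3), Nat.zero_le (m ^ 2)]

theorem mainTheorem5 :
    ∃ c : ℝ, 0 < c ∧ ∀ A : Set ℂ, A.Finite → 2 ≤ A.ncard →
      (A + A * A).ncard = {z : ℂ | ∃ x ∈ A, ∃ y ∈ A, ∃ w ∈ A, z = x + y * w}.ncard ∧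
      c * ((A.ncard : ℝ) ^ (3 / 2 : ℝ) / Real.sqrt (Real.log (A.ncard : ℝ))) ≤
        ((A + A * A).ncard : ℝ) := by
  refine ⟨1 / 40, by norm_num, fun A hA h2 => ⟨?_, ?_⟩⟩
  · congr 1
    ext z
    simp only [Set.mem_add, Set.mem_mul, Set.mem_ofPred_eq]
    constructor
    · rintro ⟨x, hx, _, ⟨y, hy, w, hw, rfl⟩, rfl⟩
      exact ⟨x, hx, y, hy, w, hw, rfl⟩
    · rintro ⟨x, hx, y, hy, w, hw, rfl⟩
      exact ⟨x, hx, _, ⟨y, hy, w, hw, rfl⟩, rfl⟩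
  · have hBf : (A + A * A).Finite := hA.add (hA.mul hA)
    have hn := Set.ncard_eq_toFinset_card A hA
    have hm := Set.ncard_eq_toFinset_card (A + A * A) hBf
    have h3 : A.ncard ^ 3 ≤ 200 * (A + A * A).ncard ^ 2 := by
      rw [hn, hm]
      refine card_pow_three_le _ _ (hn ▸ h2) ?_
      intro a ha b hb x hx
      rw [Set.Finite.mem_toFinset] at *
      exact Set.add_mem_add ha (Set.mul_mem_mul hb hx)
    generalize (A + A * A).ncard = m at h3
    generalize A.ncard = n at h2 h3
    have h3' : (n : ℝ) ^ 3 ≤ 200 * (m : ℝ) ^ 2 := by exact_mod_cast h3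
    have h2' : (2 : ℝ) ≤ n := by exact_mod_cast h2
    -- The logarithm only weakens the bound, so a constant lower bound suffices.
    have hlog : 1 / 2 ≤ Real.sqrt (Real.log n) := by
      apply Real.le_sqrt_of_sq_le
      have := Real.log_le_log (by norm_num) h2'
      linarith [Real.log_two_gt_d9]
    have hpow : (n : ℝ) ^ (3 / 2 : ℝ) ≤ 20 * m := by
      apply le_of_sq_le_sq _ (by positivity)
      rw [← Real.rpow_natCast, ← Real.rpow_mul (by positivity)]
      norm_num
      nlinarith [sq_nonneg (m : ℝ)]
    have h4 : (n : ℝ) ^ (3 / 2 : ℝ) / Real.sqrt (Real.log n) ≤ 40 * m := by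
      rw [div_le_iff₀ (by linarith)]
      nlinarith [(Nat.cast_nonneg m : (0 : ℝ) ≤ m)]
    linarith
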